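/- All Lie algebras are over $\mathbb{C}$. Let $\mathfrak{g}$ be a finite-dimensional simple Lie algebra and let $\sigma_1,\dots,\sigma_\nu$ be commuting automorphisms of $\mathfrak{g}$ with $\sigma_j^{m_j}=\mathrm{id}$, $m_j\ge 1$. Fix primitive $m_j$-th roots of unity $\omega_j$, put $\Lambda=\mathbb{Z}^\nu$, and for $\lambda\in\Lambda$ let $\mathfrak{g}^{\bar\lambda}=\{x\in\mathfrak{g}: \sigma_j(x)=\omega_j^{\lambda_j}x,\ 1\le j\le\nu\}$. Let $$\mathcal{L}=M(\mathfrak{g},\boldsymbol\sigma)=\bigoplus_{\lambda\in\Lambda}\mathfrak{g}^{\bar\lambda}\otimes z^\lambda\subseteq\mathfrak{g}\otimes\mathbb{C}[z_1^{\pm1},\dots,z_\nu^{\pm1}].$$ Let $\mathfrak{h}'$ be a subalgebra of the fixed algebra $\mathfrak{g}^{\boldsymbol\sigma}$ that is ad-diagonalizable on $\mathfrak{g}$, such that the set $\Delta$ of weights of $\mathfrak{h}'$ on $\mathfrak{g}$, together with $0$, is $\{0\}\cup\Delta^\times$ with $\Delta^\times$ a finite irreducible (crystallographic, possibly non-reduced)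 root system in $(\mathfrak{h}')^\star$; let $Q=\langle\Delta\rangle$ be its root lattice and $\mathcal{L}^\lambda_\alpha=\mathfrak{g}^{\bar\lambda}_\alpha\otimes z^\lambda$ for $\alpha\in Q$, where $\mathfrak{g}^{\bar\lambda}_\alpha$ is the intersection of $\mathfrak{g}^{\bar\lambda}$ with the $\alpha$-weight space of $\mathfrak{h}'$. Assume that $\mathcal{L}$ with these subspaces is a Lie $\Lambda$-torus of type $\Delta$, that is: 1. $\mathcal{L}=\bigoplus_{(\alpha,\lambda)\in Q\times\Lambda}\mathcal{L}^\lambda_\alpha$, $[\mathcal{L}^\lambda_\alpha,\mathcal{L}^\mu_\beta]\subseteq\mathcal{L}^{\lambda+\mu}_{\alpha+\beta}$, and $\mathcal{L}^\lambda_\alpha=0$ if $\alpha\notin\Delta$; 2. for $\alpha\in\Delta^\times$ and $\lambda\in\Lambda$: $\dim\mathcal{L}^\lambda_\alpha\le1$; $\dim\mathcal{L}^0_\alpha=1$ if $\alpha/2\notin\Delta$; and if $\dim\mathcal{L}^\lambda_\alpha=1$, there are $e,f$ with $\mathcal{L}^\lambda_\alpha=\mathbb{C}e$, $\mathcal{L}^{-\lambda}_{-\alpha}=\mathbb{C}f$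 and $[[e,f],x]=\langle\beta,\alpha^\vee\rangle x$ for all $\beta\in\Delta$, $\mu\in\Lambda$, $x\in\mathcal{L}^\mu_\beta$; 3. $\mathcal{L}^\lambda_0=\sum_{\alpha\in\Delta^\times,\,\mu\in\Lambda}[\mathcal{L}^\mu_\alpha,\mathcal{L}^{\lambda-\mu}_{-\alpha}]$ for all $\lambda\in\Lambda$; 4. $\Lambda$ is generated by $\{\lambda:\mathcal{L}^\lambda_\alpha\ne0\text{ for some }\alpha\}$. Assume also that $\mathcal{L}$ has trivial center and is fgc, i.e. finitely generated as a module over its centroid $\{\chi\in\mathrm{End}_{\mathbb{C}}(\mathcal{L}):\chi([x,y])=[\chi(x),y]=[x,\chi(y)]\ \forall x,y\}$. Finally assume that $\sigma_1,\dots,\sigma_\nu$ are graph automorphisms of $\mathfrak{g}$, i.e. for one choice of Chevalley generators $e_i,f_i,h_i$ of $\mathfrak{g}$, each $\sigma_j$ permutes the $e_i$, the $f_i$ and the $h_i$ through an automorphism of the Dynkin diagram. A Chevalley involution of $\mathcal{L}$ is a Lie algebra automorphism $\tau$ of order $2$ with $\tau(\mathcal{L}^\lambda)=\mathcal{L}^{-\lambda}$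 for all $\lambda\in\Lambda$, where $\mathcal{L}^\lambda=\bigoplus_{\alpha}\mathcal{L}^\lambda_\alpha$, and $\tau(h)=-h$ for all $h\in\mathcal{L}^0_0$. (a) If $\mathfrak{g}$ has an automorphism $\psi$ such that $\psi(\mathfrak{g}^{\bar\lambda})\subseteq\mathfrak{g}^{-\bar\lambda}$ for every $\lambda\in\Lambda$ and $\psi|_{\mathfrak{h}'}=\mathrm{id}$, then $\mathcal{L}$ has a Chevalley involution. (b) If every $\sigma_j$ has order $1$ or $2$, then $\psi=\mathrm{id}$ satisfies the two conditions in (a), and hence $\mathcal{L}$ has a Chevalley involution. -/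

import Mathlib

open scoped TensorProduct

/-! ### Lie tori over `ℂ` -/

namespace LieTorus

section Centroid

variable (L : Type*) [LieRing L] [LieAlgebra ℂ L]

/-- The centroid of a complex Lie algebra `L`: the `ℂ`-linear endomorphisms `χ` of `L` such that
`χ [x, y] = [χ x, y] = [x, χ y]` for all `x, y`. -/
def centroid : Subalgebra ℂ (Module.End ℂ L) where
  carrier := {χ | ∀ x y : L, χ ⁅x, y⁆ = ⁅χ x, y⁆ ∧ χ ⁅x, y⁆ = ⁅x, χ y⁆}
  mul_mem' {a b} ha hb x y := by
    refine ⟨?_, ?_⟩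
    · rw [Module.End.mul_apply, (hb x y).1, (ha _ _).1, Module.End.mul_apply]
    · rw [Module.End.mul_apply, (hb x y).2, (ha _ _).2, Module.End.mul_apply]
  add_mem' {a b} ha hb x y := by
    refine ⟨?_, ?_⟩
    · rw [LinearMap.add_apply, (ha x y).1, (hb x y).1, LinearMap.add_apply, add_lie]
    · rw [LinearMap.add_apply, (ha x y).2, (hb x y).2, LinearMap.add_apply, lie_add]
  algebraMap_mem' c x y := by
    simp [Module.algebraMap_end_apply]

/-- `L` is fgc: finitely generated as a module over its centroid (acting by evaluation). -/
def IsFgc : Prop := Module.Finite (centroid L) L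

end Centroid

section Torus

variable {ι V N Λ L : Type*} [AddCommGroup V] [Module ℂ V] [AddCommGroup N] [Module ℂ N]
  [AddCommGroup Λ] [LieRing L] [LieAlgebra ℂ L]

/-- The Lie algebra `L`, with the family of subspaces `𝓛 (α, l)` indexed by `Q × Λ`, is a Lie
`Λ`-torus of type `Δ`. Here `P` is a finite irreducible crystallographic, possibly non-reduced,
root system, `Δ = {0} ∪ {roots of P}`, and `Q = P.rootSpan ℤ` is its root lattice. -/
structure IsLieTorus (P : RootPairing ι ℂ V N) [Finite ι] [P.IsRootSystem] [P.IsCrystallographic]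
    [P.IsIrreducible] (𝓛 : P.rootSpan ℤ × Λ → Submodule ℂ L) : Prop where
  /-- `L` is the direct sum of the `𝓛 (α, l)`. -/
  indep : iSupIndep 𝓛
  iSup_eq_top : ⨆ p, 𝓛 p = ⊤
  lie_mem : ∀ p q : P.rootSpan ℤ × Λ, ∀ x ∈ 𝓛 p, ∀ y ∈ 𝓛 q, ⁅x, y⁆ ∈ 𝓛 (p + q)
  eq_bot : ∀ (α : P.rootSpan ℤ) (l : Λ), α ≠ 0 → (α : V) ∉ Set.range P.root → 𝓛 (α, l) = ⊥
  /-- The spaces `𝓛 (α, l)` with `α ≠ 0` have dimension at most `1`, and `𝓛 (α, 0)` has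
  dimension `1` if `α` is an indivisible root. -/
  rank_le_one : ∀ (i : ι) (l : Λ), Module.rank ℂ (𝓛 (P.rootSpanMem ℤ i, l)) ≤ 1
  rank_eq_one : ∀ i : ι, (∀ j : ι, P.root i ≠ (2 : ℕ) • P.root j) →
    Module.rank ℂ (𝓛 (P.rootSpanMem ℤ i, 0)) = 1
  /-- `P.coroot' i β` is the number `⟨β, α^∨⟩` for the root `α` with index `i`. -/
  exists_sl2 : ∀ (i : ι) (l : Λ), Module.rank ℂ (𝓛 (P.rootSpanMem ℤ i, l)) = 1 →
    ∃ e f : L, 𝓛 (P.rootSpanMem ℤ i, l) = Submodule.span ℂ {e} ∧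
      𝓛 (-P.rootSpanMem ℤ i, -l) = Submodule.span ℂ {f} ∧
      ∀ (β : P.rootSpan ℤ) (k : Λ), (β = 0 ∨ (β : V) ∈ Set.range P.root) →
        ∀ x ∈ 𝓛 (β, k), ⁅⁅e, f⁆, x⁆ = P.coroot' i (β : V) • x
  /-- `𝓛 (0, l)` is spanned by the brackets of `𝓛 (α, k)` with `𝓛 (-α, l - k)`, `α ≠ 0`. -/
  zero_eq_span : ∀ l : Λ, 𝓛 (0, l) = Submodule.span ℂ
    {z | ∃ (i : ι) (k : Λ), ∃ x ∈ 𝓛 (P.rootSpanMem ℤ i, k),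
      ∃ y ∈ 𝓛 (-P.rootSpanMem ℤ i, l - k), z = ⁅x, y⁆}
  /-- `Λ` is generated by the support of `L`. -/
  closure_supp : AddSubgroup.closure {l : Λ | ∃ α : P.rootSpan ℤ, 𝓛 (α, l) ≠ ⊥} = ⊤

/-- An automorphism `τ` of a `Λ`-graded Lie algebra is a pre-Chevalley involution if it has order
two and maps the component of degree `l` onto the component of degree `-l`. -/
structure IsPreChevalleyInvolution (𝓛 : Λ → Submodule ℂ L) (τ : L ≃ₗ⁅ℂ⁆ L) : Prop where
  involutive : ∀ x, τ (τ x) = x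
  ne_id : ∃ x, τ x ≠ x
  map_eq : ∀ l, (𝓛 l).map (τ : L →ₗ[ℂ] L) = 𝓛 (-l)

/-- A Chevalley involution of a `Q × Λ`-graded Lie algebra `L` is a pre-Chevalley involution for
the `Λ`-grading with components `⨆ α, 𝓛 (α, l)` which is `-1` on `𝓛 (0, 0)`. -/
structure IsChevalleyInvolution {Q : Type*} [AddCommGroup Q] (𝓛 : Q × Λ → Submodule ℂ L)
    (τ : L ≃ₗ⁅ℂ⁆ L) : Prop where
  preChevalley : IsPreChevalleyInvolution (fun l : Λ ↦ ⨆ α : Q, 𝓛 (α, l)) τ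
  apply_zero : ∀ h ∈ 𝓛 (0, 0), τ h = -h

end Torus

end LieTorus

/-! ### Multi-loop algebras -/

namespace MultiLoop

variable {g : Type*} [LieRing g] [LieAlgebra ℂ g] {ν : ℕ}

/-- The joint eigenspace `{x ∈ g | σ_j x = ω_j ^ l_j x for all j}`. -/
def eigenspace (σ : Fin ν → (g ≃ₗ⁅ℂ⁆ g)) (ω : Fin ν → ℂˣ) (l : Fin ν → ℤ) : Submodule ℂ g where
  carrier := {x | ∀ j, σ j x = (ω j : ℂ) ^ l j • x}
  add_mem' hx hy j := by rw [map_add, hx j, hy j, smul_add]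
  zero_mem' j := by simp
  smul_mem' c x hx j := by rw [map_smul, hx j, smul_comm]

/-- The weight space `{x ∈ g | [h, x] = α(h) x for all h ∈ h'}`. -/
def weightSpace (h' : LieSubalgebra ℂ g) (α : Module.Dual ℂ h') : Submodule ℂ g where
  carrier := {x | ∀ h : h', ⁅(h : g), x⁆ = α h • x}
  add_mem' hx hy h := by rw [lie_add, hx h, hy h, smul_add]
  zero_mem' h := by simp
  smul_mem' c x hx h := by rw [lie_smul, hx h, smul_comm]

/-- For a subspace `U` of `g`, the subspace `U ⊗ z^l` of `g ⊗ ℂ[z_1^{±1}, …, z_ν^{±1}]`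
(with the two tensor factors written in the other order). -/
noncomputable def monomialTensor (l : Fin ν → ℤ) (U : Submodule ℂ g) :
    Submodule ℂ (LieAlgebra.loopAlgebra ℂ (Fin ν → ℤ) g) :=
  U.map (TensorProduct.mk ℂ (AddMonoidAlgebra ℂ (Fin ν → ℤ)) g (AddMonoidAlgebra.single l 1))

theorem lie_mem_eigenspace {σ : Fin ν → (g ≃ₗ⁅ℂ⁆ g)} {ω : Fin ν → ℂˣ}
    {l k : Fin ν → ℤ} {x y : g} (hx : x ∈ eigenspace σ ω l) (hy : y ∈ eigenspace σ ω k) :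
    ⁅x, y⁆ ∈ eigenspace σ ω (l + k) := by
  intro j
  rw [LieEquiv.map_lie, hx j, hy j, smul_lie, lie_smul, smul_smul, Pi.add_apply,
    zpow_add₀ (ω j).ne_zero]

/-- The multi-loop algebra `M(g, σ) = ⨁_l g^l ⊗ z^l`, where `g^l` is the joint eigenspace
of `σ = (σ_1, …, σ_ν)` for the eigenvalues `ω_j ^ l_j`. -/
noncomputable def multiLoop (σ : Fin ν → (g ≃ₗ⁅ℂ⁆ g)) (ω : Fin ν → ℂˣ) :
    LieSubalgebra ℂ (LieAlgebra.loopAlgebra ℂ (Fin ν → ℤ) g) where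
  toSubmodule := ⨆ l : Fin ν → ℤ, monomialTensor l (eigenspace σ ω l)
  lie_mem' {a b} ha hb := by
    simp only [AddSubsemigroup.mem_carrier, AddSubmonoid.mem_toSubsemigroup,
      Submodule.mem_toAddSubmonoid] at ha hb ⊢
    induction ha using Submodule.iSup_induction' with
    | zero => rw [zero_lie]; exact Submodule.zero_mem _
    | add x y _ _ hx hy => rw [add_lie]; exact Submodule.add_mem _ hx hy
    | mem l x hx =>
      induction hb using Submodule.iSup_induction' with
      | zero => rw [lie_zero]; exact Submodule.zero_mem _
      | add y z _ _ hy hz => rw [lie_add]; exact Submodule.add_mem _ hy hz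
      | mem k y hy =>
        obtain ⟨u, hu, rfl⟩ := hx
        obtain ⟨v, hv, rfl⟩ := hy
        refine Submodule.mem_iSup_of_mem (l + k) ⟨⁅u, v⁆, lie_mem_eigenspace hu hv, ?_⟩
        simp [AddMonoidAlgebra.single_mul_single]

/-- The grading of `M(g, σ) = LT(g, σ, h')` by `Q × ℤ^ν`, for a subgroup `Q` of the dual of `h'`:
the component of degree `(α, l)` is `g_α^l ⊗ z^l`, with `g_α^l` the intersection of the joint
eigenspace `g^l` and the `α`-weight space of `h'` on `g`. -/
noncomputable def grading (σ : Fin ν → (g ≃ₗ⁅ℂ⁆ g)) (ω : Fin ν → ℂˣ)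
    (h' : LieSubalgebra ℂ g) (Q : Submodule ℤ (Module.Dual ℂ h')) (p : Q × (Fin ν → ℤ)) :
    Submodule ℂ (multiLoop σ ω) :=
  (monomialTensor p.2 (eigenspace σ ω p.2 ⊓ weightSpace h' (p.1 : Module.Dual ℂ h'))).comap
    (multiLoop σ ω).toSubmodule.subtype

/-- `σ` is a graph automorphism with respect to Chevalley generators `e_i, f_i, h_i` of `g`: it
permutes the generators through an automorphism of the Dynkin diagram (Cartan matrix). -/
def IsGraphAutomorphism {κ : Type*} [Finite κ] {H : LieSubalgebra ℂ g}
    (b : LieAlgebra.Basis κ H) (σ : g ≃ₗ⁅ℂ⁆ g) : Prop :=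
  ∃ ρ : Equiv.Perm κ, (∀ i j, b.A (ρ i) (ρ j) = b.A i j) ∧
    (∀ i, σ (b.e i) = b.e (ρ i)) ∧ (∀ i, σ (b.f i) = b.f (ρ i)) ∧ ∀ i, σ (b.h i) = b.h (ρ i)

/-- The condition on the auxiliary automorphism `ψ` of `g`: it maps each `g^l` into `g^{-l}` and
is the identity on `h'`. -/
structure IsReversing (σ : Fin ν → (g ≃ₗ⁅ℂ⁆ g)) (ω : Fin ν → ℂˣ) (h' : LieSubalgebra ℂ g)
    (ψ : g ≃ₗ⁅ℂ⁆ g) : Prop where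
  map_mem : ∀ l : Fin ν → ℤ, ∀ x ∈ eigenspace σ ω l, ψ x ∈ eigenspace σ ω (-l)
  apply_eq : ∀ h ∈ h', ψ h = h

end MultiLoop

/-!
# Chevalley involutions of multi-loop Lie tori twisted by graph automorphisms

Let `τ` be the map `x ⊗ z^l ↦ χ x ⊗ z^{-l}`, where `χ` is an automorphism of `g` mapping each
`g^l` into `g^{-l}` and equal to `-1` on `h'`. It preserves `M(g, σ)`, reverses the grading by
`Q × ℤ^ν`, and is `-1` in degree `(0, 0)`, since that component is `h' ⊗ 1`
(`MultiLoop.exists_monomial_eq_of_mem_grading_zero`). That `τ` has order two need not be imposed on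
`χ`: on an `sl₂`-triple of the torus `τ` exchanges the lines of `e` and `f` up to scalars whose
product must be `1`, and these triples generate (`LieTorus.IsLieTorus.involutive`).

Given an automorphism `ψ` that maps each `g^l` into `g^{-l}` and fixes `h'` pointwise, one takes
`χ = ψ ∘ θ` for an automorphism `θ` of `g` that commutes with all
`σ_j` and is `-1` on `h'`. The Chevalley involution `e_i ↦ f_i`, `f_i ↦ e_i`, `h_i ↦ -h_i` commutes
with graph automorphisms but is `-1` on the Cartan subalgebra `H` of the Chevalley generators, so it
has to be conjugated. Both `H ∩ g^σ` and `h'` are abelian Engel subalgebras of the fixed-point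
algebra `g^σ`: the former belongs to the element on which all simple roots are `1`, which graph
automorphisms fix; the latter to any element of `h'` at which no root vanishes, because
`h' = (g^σ)_0`. Cartan subalgebras of `g^σ` are conjugate under products of automorphisms
`exp (ad x)` with `x ∈ g^σ` (`engelConj_of_isRegular`), and these extend to automorphisms of `g`
commuting with all `σ_j`.

Conjugacy is proved analytically. Near a regular point every regular point is conjugate to an
element with the same Engel subalgebra, as `(x, c) ↦ exp (ad x) c` is a submersion at `(0, h)`
(`eventually_eq_expAd`); and the regular points of a complex line form a connected set, the
complement of a finite set.
-/

/-! ### Chevalley involution and principal grading element of a simple Lie algebra -/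

namespace LieAlgebra.Basis

open Set

variable {κ g : Type*} [Finite κ] [LieRing g] [LieAlgebra ℂ g] {H : LieSubalgebra ℂ g}

/-- A Lie algebra homomorphism is determined by its values on the generators `e i`, `f i`. -/
theorem hom_ext {g' : Type*} [LieRing g'] [LieAlgebra ℂ g'] (b : Basis κ H) {φ φ' : g →ₗ⁅ℂ⁆ g'}
    (he : ∀ i, φ (b.e i) = φ' (b.e i)) (hf : ∀ i, φ (b.f i) = φ' (b.f i)) : φ = φ' := by
  ext x
  have hx : x ∈ LieSubalgebra.lieSpan ℂ g (range b.e ∪ range b.f) := by simp [b.span_ef]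
  induction hx using LieSubalgebra.lieSpan_induction with
  | mem x hx =>
    rcases hx with ⟨i, rfl⟩ | ⟨i, rfl⟩
    exacts [he i, hf i]
  | zero => simp
  | add x y _ _ hx hy => simp [hx, hy]
  | smul c x _ hx => simp [hx]
  | lie x y _ _ hx hy => simp [hx, hy]

/-- An element commuting with all `e i` and `f i` is central, hence zero. -/
theorem eq_zero_of_lie_generators [IsSimple ℂ g] [FiniteDimensional ℂ g] (b : Basis κ H) {x : g}
    (he : ∀ i, ⁅x, b.e i⁆ = 0) (hf : ∀ i, ⁅x, b.f i⁆ = 0) : x = 0 := by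
  have hx : x ∈ center ℂ g := by
    rw [LieModule.mem_maxTrivSubmodule]
    intro y
    have hy : y ∈ LieSubalgebra.lieSpan ℂ g (range b.e ∪ range b.f) := by simp [b.span_ef]
    rw [← lie_skew, neg_eq_zero]
    induction hy using LieSubalgebra.lieSpan_induction with
    | mem y hy =>
      rcases hy with ⟨i, rfl⟩ | ⟨i, rfl⟩
      exacts [he i, hf i]
    | zero => simp
    | add y z _ _ hy hz => simp [hy, hz]
    | smul c y _ hy => simp [hy]
    | lie y z _ _ hy hz => simp [leibniz_lie x y z, hy, hz]
  rw [center_eq_bot] at hx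
  simpa using hx

/-- There is an element of the Cartan subalgebra on which all simple roots take the value `1`. -/
theorem exists_baseSupp_eq_one [Fintype κ] (b : Basis κ H) : ∃ d : H, ∀ i, b.baseSupp i d = 1 := by
  classical
  have hdet : IsUnit ((Int.castRingHom ℂ).mapMatrix b.A).det := by
    rw [← RingHom.map_det, isUnit_iff_ne_zero]
    simpa using b.nondegen.det_ne_zero
  set M := (Int.castRingHom ℂ).mapMatrix b.A
  refine ⟨∑ j, (M⁻¹.mulVec 1) j • b.h' j, fun i ↦ ?_⟩
  have : (M.mulVec (M⁻¹.mulVec 1)) i = 1 := by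
    rw [Matrix.mulVec_mulVec, Matrix.mul_nonsing_inv _ hdet, Matrix.one_mulVec, Pi.one_apply]
  rw [← this, map_sum]
  simp [Matrix.mulVec, dotProduct, M, mul_comm]

variable [FiniteDimensional ℂ g] [IsSimple ℂ g]

/-- The Chevalley involution attached to Chevalley generators: the isomorphism theorem applied to
the generators `e i, f i, h i` and `f i, e i, -h i`. -/
noncomputable def chevalleyInvolution (b : Basis κ H) : g ≃ₗ⁅ℂ⁆ g :=
  equivOfReindex (Equiv.refl κ) b b.symm (by simp)

/-- The automorphism carrying one Chevalley basis to another with the same Cartan matrix is the one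
whose graph is generated by the pairs of corresponding generators. -/
theorem equivOfReindex_refl_apply (b₁ b₂ : Basis κ H) (hA) {x y : g}
    (hxy : (x, y) ∈ LieSubalgebra.lieSpan ℂ (g × g)
      ({(b₁.h i, b₂.h i) | i : κ} ∪ {(b₁.e i, b₂.e i) | i : κ} ∪ {(b₁.f i, b₂.f i) | i : κ})) :
    equivOfReindex (Equiv.refl κ) b₁ b₂ hA x = y := by
  -- `equivOfReindex` is the inverse of the first projection of the graph, followed by the second
  have key {G : LieSubalgebra ℂ (g × g)} (e₁ e₂ : G ≃ₗ⁅ℂ⁆ g) (z : G) (h₁ : e₁ z = x)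
      (h₂ : e₂ z = y) : e₂ (e₁.symm x) = y := by
    rw [← h₁, LieEquiv.symm_apply_apply, h₂]
  unfold equivOfReindex
  rw [LieEquiv.trans_apply]
  exact key _ _ ⟨(x, y), hxy⟩ rfl rfl

theorem chevalleyInvolution_e (b : Basis κ H) (i : κ) : b.chevalleyInvolution (b.e i) = b.f i :=
  equivOfReindex_refl_apply _ _ _ (LieSubalgebra.subset_lieSpan (.inl (.inr ⟨i, rfl⟩)))

theorem chevalleyInvolution_f (b : Basis κ H) (i : κ) : b.chevalleyInvolution (b.f i) = b.e i :=
  equivOfReindex_refl_apply _ _ _ (LieSubalgebra.subset_lieSpan (.inr ⟨i, rfl⟩))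

theorem chevalleyInvolution_h (b : Basis κ H) (i : κ) :
    b.chevalleyInvolution (b.h i) = -b.h i :=
  equivOfReindex_refl_apply _ _ _ (LieSubalgebra.subset_lieSpan (.inl (.inl ⟨i, rfl⟩)))

theorem chevalleyInvolution_of_mem (b : Basis κ H) {x : g} (hx : x ∈ H) :
    b.chevalleyInvolution x = -x := by
  rw [← LieSubalgebra.mem_toSubmodule, b.coe_cartan_eq_span] at hx
  induction hx using Submodule.span_induction with
  | mem x hx =>
    obtain ⟨i, rfl⟩ := hx
    exact b.chevalleyInvolution_h i
  | zero => simp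
  | add x y _ _ hx hy => rw [map_add, hx, hy, neg_add]
  | smul c x _ hx => rw [map_smul, hx, smul_neg]

/-- Graph automorphisms commute with the Chevalley involution. -/
theorem chevalleyInvolution_comm (b : Basis κ H) {σ : g ≃ₗ⁅ℂ⁆ g}
    (hσ : MultiLoop.IsGraphAutomorphism b σ) (x : g) :
    b.chevalleyInvolution (σ x) = σ (b.chevalleyInvolution x) := by
  obtain ⟨ρ, -, he, hf, -⟩ := hσ
  have : (b.chevalleyInvolution.toLieHom).comp σ.toLieHom =
      σ.toLieHom.comp b.chevalleyInvolution.toLieHom := by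
    apply b.hom_ext <;> intro i <;>
    simp [he, hf, chevalleyInvolution_e, chevalleyInvolution_f]
  exact congr($this x)

end LieAlgebra.Basis

/-- If `W` lies in the generalised `0`-eigenspace of `T` and has a complement inside the sum of the
generalised eigenspaces for nonzero eigenvalues, then `W` is the generalised `0`-eigenspace. -/
theorem Module.End.maxGenEigenspace_zero_eq_of_sup_eq_top {V : Type*} [AddCommGroup V] [Module ℂ V]
    (T : Module.End ℂ V) {W U : Submodule ℂ V} (hW : W ≤ T.maxGenEigenspace 0)
    (hU : U ≤ ⨆ μ ≠ (0 : ℂ), T.maxGenEigenspace μ) (htop : W ⊔ U = ⊤) :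
    T.maxGenEigenspace 0 = W := by
  have hdisj : T.maxGenEigenspace 0 ⊓ U = ⊥ :=
    ((Module.End.independent_maxGenEigenspace T 0).mono_right hU).eq_bot
  refine le_antisymm ?_ hW
  calc T.maxGenEigenspace 0 = (W ⊔ U) ⊓ T.maxGenEigenspace 0 := by rw [htop, top_inf_eq]
    _ = W := by rw [sup_inf_assoc_of_le _ hW, inf_comm, hdisj, sup_bot_eq]
    _ ≤ W := le_rfl

namespace LieAlgebra.Basis

variable {κ g : Type*} [Fintype κ] [LieRing g] [LieAlgebra ℂ g]
  {H : LieSubalgebra ℂ g}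

/-- An element of the Cartan subalgebra on which all simple roots take the value `1` is regular. -/
theorem engel_eq_of_baseSupp_eq_one (b : Basis κ H) {d : H} (hd : ∀ i, b.baseSupp i d = 1) :
    LieSubalgebra.engel ℂ (d : g) = H := by
  let := b.isLieAbelian_cartan
  have key (χ : H → ℂ) : (rootSpace H χ : Submodule ℂ g) ≤
      (ad ℂ g (d : g)).maxGenEigenspace (χ d) := by
    intro x hx
    obtain ⟨k, hk⟩ := (LieModule.mem_genWeightSpace _ _ _).1 hx d
    exact (Module.End.mem_maxGenEigenspace _ _ _).2 ⟨k, hk⟩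
  have hne (n : κ → ℕ) (hn : n ≠ 0) : (∑ i, (n i : ℂ)) ≠ 0 := by
    rw [← Nat.cast_sum, Nat.cast_ne_zero]
    contrapose! hn
    ext i
    simpa using (Finset.sum_eq_zero_iff.1 hn) i (Finset.mem_univ i)
  have htop := b.iSup_cartan_borelLower_borelUpper_eq_top
  have htop' : (H.toSubmodule) ⊔ ((b.borelLower : Submodule ℂ g) ⊔ (b.borelUpper : Submodule ℂ g))
      = ⊤ := by
    have h2 : H.toLieSubmodule ⊔ (b.borelLower ⊔ b.borelUpper) = ⊤ := by
      rw [← htop, ← sup_assoc]; simp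
    have := congr(($h2 : Submodule ℂ g))
    simpa using this
  have := Module.End.maxGenEigenspace_zero_eq_of_sup_eq_top (ad ℂ g (d : g)) (W := H.toSubmodule)
    (U := (b.borelLower : Submodule ℂ g) ⊔ (b.borelUpper : Submodule ℂ g)) ?_ ?_ htop'
  · exact LieSubalgebra.toSubmodule_injective this
  · have h0 := key 0
    rw [← b.cartan_eq] at h0
    exact h0
  · rw [b.borelLower_eq, b.borelUpper_eq]
    simp only [LieSubmodule.iSup_toSubmodule]
    refine sup_le (iSup₂_le fun n hn ↦ ?_) (iSup₂_le fun n hn ↦ ?_)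
    · refine (key _).trans (le_iSup₂_of_le _ ?_ le_rfl)
      simpa [hd] using hne n hn
    · refine (key _).trans (le_iSup₂_of_le _ ?_ le_rfl)
      simpa [hd] using hne n hn

variable [FiniteDimensional ℂ g] [IsSimple ℂ g]

/-- A graph automorphism fixes the element on which all simple roots take the value `1`. -/
theorem apply_eq_of_baseSupp_eq_one (b : Basis κ H) {d : H} (hd : ∀ i, b.baseSupp i d = 1)
    {σ : g ≃ₗ⁅ℂ⁆ g} (hσ : MultiLoop.IsGraphAutomorphism b σ) : σ d = d := by
  obtain ⟨ρ, -, he, hf, -⟩ := hσ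
  have hde (i : κ) : ⁅(d : g), b.e i⁆ = b.e i := by
    simpa [hd] using (b.baseSupp_apply_smul_e i d).symm
  have hdf (i : κ) : ⁅(d : g), b.f i⁆ = -b.f i := by
    have := b.baseSupp_apply_smul_f i d
    rw [hd, one_smul] at this
    simpa using congr(-$this).symm
  rw [← sub_eq_zero]
  apply b.eq_zero_of_lie_generators <;> intro i <;> obtain ⟨i, rfl⟩ := ρ.surjective i <;>
  rw [sub_lie]
  · rw [← he, ← LieEquiv.map_lie, he, hde, hde, he, sub_self]
  · rw [← hf, ← LieEquiv.map_lie, hf, hdf, hdf, map_neg, hf, sub_self]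

end LieAlgebra.Basis

/-! ### Exponentials of endomorphisms and of derivations -/

section Exponential

open Module NormedSpace

variable {V W : Type*} [AddCommGroup V] [Module ℂ V] [FiniteDimensional ℂ V]
  [AddCommGroup W] [Module ℂ W] [FiniteDimensional ℂ W]

/-- The endomorphism algebra of `V` is identified with the normed algebra of endomorphisms of
`ℂⁿ` by a choice of coordinates. -/
noncomputable def endCoord (V : Type*) [AddCommGroup V] [Module ℂ V] [FiniteDimensional ℂ V] :
    Module.End ℂ V ≃ₐ[ℂ] ((Fin (finrank ℂ V) → ℂ) →L[ℂ] (Fin (finrank ℂ V) → ℂ)) :=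
  ((finBasis ℂ V).equivFun.conjAlgEquiv ℂ).trans (Module.End.toContinuousLinearMap _)

/-- The exponential of an endomorphism of a finite-dimensional complex vector space, computed in
coordinates. -/
noncomputable def linExp (D : Module.End ℂ V) : Module.End ℂ V :=
  (endCoord V).symm (exp (endCoord V D))

theorem endCoord_symm_apply (A : (Fin (finrank ℂ V) → ℂ) →L[ℂ] (Fin (finrank ℂ V) → ℂ)) (v : V) :
    (endCoord V).symm A v = (finBasis ℂ V).equivFun.symm (A ((finBasis ℂ V).equivFun v)) := rfl

theorem hasSum_linExp (D : Module.End ℂ V) (f : Module.Dual ℂ V) (v : V) :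
    HasSum (fun n : ℕ ↦ (n.factorial : ℂ)⁻¹ • f ((D ^ n) v)) (f (linExp D v)) := by
  let ℓ : ((Fin (finrank ℂ V) → ℂ) →L[ℂ] (Fin (finrank ℂ V) → ℂ)) →ₗ[ℂ] ℂ :=
    f ∘ₗ LinearMap.applyₗ v ∘ₗ (endCoord V).symm.toLinearMap
  have h := (exp_series_hasSum_exp' (𝕂 := ℂ) (endCoord V D)).map ℓ
    ℓ.continuous_of_finiteDimensional
  convert h using 2 with n
  · rw [Function.comp_apply, map_smul, ← map_pow]
    simp [ℓ]
  · rfl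

/-- Exponentials are natural with respect to linear maps intertwining two endomorphisms. -/
theorem linExp_intertwine {D : Module.End ℂ V} {D' : Module.End ℂ W} {f : V →ₗ[ℂ] W}
    (h : ∀ v, f (D v) = D' (f v)) (v : V) : f (linExp D v) = linExp D' (f v) := by
  have hpow (n : ℕ) : f ((D ^ n) v) = (D' ^ n) (f v) := by
    induction n with
    | zero => simp
    | succ n ih => rw [pow_succ', pow_succ', Module.End.mul_apply, Module.End.mul_apply, h, ih]
  rw [← sub_eq_zero, ← Module.forall_dual_apply_eq_zero_iff ℂ]
  intro ξ
  rw [map_sub, sub_eq_zero]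
  have h₁ := hasSum_linExp D (ξ ∘ₗ f) v
  have h₂ := hasSum_linExp D' ξ (f v)
  simp only [LinearMap.comp_apply, hpow] at h₁
  exact h₁.unique h₂

theorem linExp_add {D D' : Module.End ℂ V} (h : Commute D D') :
    linExp (D + D') = linExp D * linExp D' := by
  let : NormedAlgebra ℚ ((Fin (finrank ℂ V) → ℂ) →L[ℂ] (Fin (finrank ℂ V) → ℂ)) :=
    .restrictScalars ℚ ℂ _
  rw [linExp, map_add, exp_add_of_commute (h.map (endCoord V)), map_mul]
  rfl

theorem linExp_zero : linExp (0 : Module.End ℂ V) = 1 := by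
  simp [linExp]

theorem linExp_neg_apply (D : Module.End ℂ V) (v : V) : linExp (-D) (linExp D v) = v := by
  rw [← Module.End.mul_apply, ← linExp_add (Commute.refl D).neg_left, neg_add_cancel, linExp_zero,
    Module.End.one_apply]

variable {g : Type*} [LieRing g] [LieAlgebra ℂ g] [FiniteDimensional ℂ g]

/-- The exponential of `ad x` is multiplicative: the bracket intertwines `D ⊗ 1 + 1 ⊗ D` and the
derivation `D = ad x`, and the exponential of the former is `exp D ⊗ exp D`. -/
theorem linExp_ad_lie (x y z : g) :
    linExp (LieAlgebra.ad ℂ g x) ⁅y, z⁆ =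
      ⁅linExp (LieAlgebra.ad ℂ g x) y, linExp (LieAlgebra.ad ℂ g x) z⁆ := by
  set D : Module.End ℂ g := LieAlgebra.ad ℂ g x with hD
  let D₁ : Module.End ℂ (g ⊗[ℂ] g) := D.rTensor g
  let D₂ : Module.End ℂ (g ⊗[ℂ] g) := D.lTensor g
  let μ : g ⊗[ℂ] g →ₗ[ℂ] g := (LieModule.toModuleHom ℂ g g : g ⊗[ℂ] g →ₗ[ℂ] g)
  have hμ (a b : g) : μ (a ⊗ₜ b) = ⁅a, b⁆ := LieModule.toModuleHom_apply ℂ g g a b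
  have hcomm : Commute D₁ D₂ := by
    ext a b
    simp [D₁, D₂]
  have hint (w : g ⊗[ℂ] g) : μ ((D₁ + D₂) w) = D (μ w) := by
    induction w using TensorProduct.induction_on with
    | zero => simp
    | add a b ha hb => simp only [map_add, ha, hb]
    | tmul a b => simp [D₁, D₂, hμ, hD]
  have h₁ (a b : g) : linExp D₁ (a ⊗ₜ b) = linExp D a ⊗ₜ[ℂ] b :=
    (linExp_intertwine (f := (TensorProduct.mk ℂ g g).flip b) (D := D) (by simp [D₁]) a).symm
  have h₂ (a b : g) : linExp D₂ (a ⊗ₜ b) = a ⊗ₜ[ℂ] linExp D b :=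
    (linExp_intertwine (f := TensorProduct.mk ℂ g g a) (D := D) (by simp [D₂]) b).symm
  rw [← hμ y z, ← linExp_intertwine hint, linExp_add hcomm, Module.End.mul_apply, h₂, h₁, hμ]

/-- The inner automorphism `exp (ad x)`. -/
noncomputable def expAd (x : g) : g ≃ₗ⁅ℂ⁆ g where
  __ := linExp (LieAlgebra.ad ℂ g x)
  map_lie' := linExp_ad_lie x _ _
  invFun := linExp (-LieAlgebra.ad ℂ g x)
  left_inv y := linExp_neg_apply _ y
  right_inv y := by
    simpa using linExp_neg_apply (-LieAlgebra.ad ℂ g x) y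

theorem expAd_apply (x y : g) : expAd x y = linExp (LieAlgebra.ad ℂ g x) y := rfl

theorem map_expAd {g' : Type*} [LieRing g'] [LieAlgebra ℂ g'] [FiniteDimensional ℂ g']
    (f : g →ₗ⁅ℂ⁆ g') (x y : g) : f (expAd x y) = expAd (f x) (f y) := by
  rw [expAd_apply, expAd_apply]
  refine linExp_intertwine (f := (f : g →ₗ[ℂ] g')) (fun v ↦ ?_) y
  exact f.map_lie x v

end Exponential

/-! ### Conjugacy of Cartan subalgebras -/

section Conjugacy

open Module LieAlgebra LieSubalgebra Filter Topology

variable {g : Type*} [LieRing g] [LieAlgebra ℂ g]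

theorem mem_engel_subalgebra_iff {A : LieSubalgebra ℂ g} {h x : A} :
    x ∈ engel ℂ h ↔ (x : g) ∈ engel ℂ (h : g) := by
  simp only [mem_engel_iff, ← LieSubalgebra.coe_ad_pow, ZeroMemClass.coe_eq_zero]

theorem apply_mem_engel_iff (φ : g ≃ₗ⁅ℂ⁆ g) {x y : g} : φ y ∈ engel ℂ (φ x) ↔ y ∈ engel ℂ x := by
  have hpow (n : ℕ) : ((ad ℂ g (φ x)) ^ n) (φ y) = φ (((ad ℂ g x) ^ n) y) := by
    induction n with
    | zero => simp
    | succ n ih => simp [pow_succ', ih, LieEquiv.map_lie]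
  simp only [mem_engel_iff, hpow, map_eq_zero_iff φ φ.injective]

theorem finrank_engel_apply (φ : g ≃ₗ⁅ℂ⁆ g) (x : g) :
    finrank ℂ (engel ℂ (φ x)) = finrank ℂ (engel ℂ x) := by
  have : (engel ℂ (φ x)).toSubmodule = (engel ℂ x).toSubmodule.map φ.toLinearEquiv.toLinearMap := by
    ext y
    obtain ⟨y, rfl⟩ : ∃ w, φ w = y := ⟨φ.symm y, φ.apply_symm_apply y⟩
    simp only [LieSubalgebra.mem_toSubmodule, apply_mem_engel_iff, Submodule.mem_map]
    constructor
    · exact fun hy ↦ ⟨y, hy, rfl⟩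
    · rintro ⟨z, hz, hzy⟩
      rwa [← φ.injective hzy]
  change finrank ℂ (engel ℂ (φ x)).toSubmodule = finrank ℂ (engel ℂ x).toSubmodule
  rw [this, LinearEquiv.finrank_map_eq]

variable [FiniteDimensional ℂ g]

/-- If `g = [g, h] + S` with `h ∈ S`, then the points of `g` near `h` are conjugate to points of
`S`: the map `(x, c) ↦ exp (ad x) c` is a submersion at `(0, h)`. -/
theorem eventually_eq_expAd {h : g} {S : Submodule ℂ g} (hS : h ∈ S)
    (hsurj : ∀ y : g, ∃ x : g, ∃ c ∈ S, y = ⁅x, h⁆ + c) (z : g) :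
    ∀ᶠ t : ℂ in 𝓝 0, ∃ x : g, ∃ c ∈ S, h + t • z = expAd x c := by
  let E := Fin (finrank ℂ g) → ℂ
  let E' := Fin (finrank ℂ S) → ℂ
  let e : g ≃ₗ[ℂ] E := (finBasis ℂ g).equivFun
  let k : S ≃ₗ[ℂ] E' := (finBasis ℂ S).equivFun
  let s : E' →L[ℂ] E := (e.toLinearMap ∘ₗ S.subtype ∘ₗ k.symm.toLinearMap).toContinuousLinearMap
  let A : E →L[ℂ] (E →L[ℂ] E) :=
    ((endCoord g).toLinearMap ∘ₗ (ad ℂ g : g →ₗ[ℂ] Module.End ℂ g) ∘ₗ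
      e.symm.toLinearMap).toContinuousLinearMap
  let p₀ : E × E' := (0, k ⟨h, hS⟩)
  let F : E × E' → E := fun p ↦ NormedSpace.exp (A p.1) (s p.2)
  have hA (x : E) (v : g) : A x (e v) = e ⁅e.symm x, v⁆ := by
    change e (ad ℂ g (e.symm x) (e.symm (e v))) = _
    rw [e.symm_apply_apply, ad_apply]
  have hs (c : S) : s (k c) = e c := by simp [s]
  have hF (x : E) (c : E') : F (x, c) = e (expAd (e.symm x) (k.symm c : g)) := by
    rw [expAd_apply, linExp, endCoord_symm_apply]
    change _ = e (e.symm _)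
    rw [e.apply_symm_apply]
    rfl
  have hexp : HasStrictFDerivAt (fun p : E × E' ↦ NormedSpace.exp (A p.1))
      (A ∘L ContinuousLinearMap.fst ℂ E E') p₀ := by
    have h₀ : HasStrictFDerivAt NormedSpace.exp (1 : (E →L[ℂ] E) →L[ℂ] (E →L[ℂ] E))
        ((A ∘L ContinuousLinearMap.fst ℂ E E') p₀) := by
      simpa [p₀] using hasStrictFDerivAt_exp_zero (𝕂 := ℂ) (𝔸 := E →L[ℂ] E)
    exact h₀.comp p₀ (A ∘L ContinuousLinearMap.fst ℂ E E').hasStrictFDerivAt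
  have hderiv := hexp.clm_apply ((s ∘L ContinuousLinearMap.snd ℂ E E').hasStrictFDerivAt (x := p₀))
  have hF₀ : F p₀ = e h := by simp [F, p₀, hs]
  have hmap := hderiv.map_nhds_eq_of_surj (by
    rw [LinearMap.range_eq_top]
    intro y
    obtain ⟨x, c, hc, hxc⟩ := hsurj (e.symm y)
    refine ⟨(e x, k ⟨c, hc⟩), ?_⟩
    have hy : y = e (⁅x, h⁆ + c) := by rw [← hxc, e.apply_symm_apply]
    rw [hy]
    simp [p₀, hs, hA, add_comm])
  have hrange : Set.range F ∈ 𝓝 (e h) := by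
    rw [← hF₀]
    change _ ∈ 𝓝 ((fun p : E × E' ↦ NormedSpace.exp (A p.1) (s p.2)) p₀)
    exact hmap ▸ range_mem_map
  have hcont : Tendsto (fun t : ℂ ↦ e h + t • e z) (𝓝 0) (𝓝 (e h)) := by
    have : Continuous fun t : ℂ ↦ e h + t • e z := by fun_prop
    simpa using this.tendsto 0
  filter_upwards [hcont hrange] with t ⟨⟨x, c⟩, hxc⟩
  refine ⟨e.symm x, k.symm c, (k.symm c).2, e.injective ?_⟩
  rw [← hF, hxc, map_add, map_smul]

/-- Fitting decomposition of `g` with respect to `ad h`. -/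
theorem exists_eq_lie_add_engel (h y : g) :
    ∃ x : g, ∃ c ∈ (engel ℂ h).toSubmodule, y = ⁅x, h⁆ + c := by
  have hcompl := LinearMap.isCompl_iSup_ker_pow_iInf_range_pow (ad ℂ g h)
  obtain ⟨c, hc, r, hr, rfl⟩ := Submodule.mem_sup.1 (hcompl.sup_eq_top ▸ Submodule.mem_top (x := y))
  obtain ⟨w, hw⟩ := (Submodule.mem_iInf _).1 hr 1
  refine ⟨-w, c, ?_, ?_⟩
  · change c ∈ (ad ℂ g h).maxGenEigenspace 0
    have hle : (⨆ n, LinearMap.ker (ad ℂ g h ^ n)) ≤ (ad ℂ g h).maxGenEigenspace 0 :=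
      iSup_le fun n x hx ↦ (Module.End.mem_maxGenEigenspace _ _ _).2 ⟨n, by simpa using hx⟩
    exact hle hc
  · rw [← hw, neg_lie, lie_skew, add_comm]
    simp

/-- The Engel subalgebra of a regular element is minimal among Engel subalgebras, hence contained
in the Engel subalgebras of all its elements. -/
theorem engel_le_engel_of_isRegular {x : g} (hx : IsRegular ℂ x) {c : g} (hc : c ∈ engel ℂ x) :
    engel ℂ x ≤ engel ℂ c := by
  have hmin : IsMin (⟨engel ℂ x, x, self_mem_engel ℂ x, rfl⟩ :
      {engel ℂ y | y ∈ engel ℂ x}) := by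
    rintro ⟨_, y, hy, rfl⟩ hle
    refine (LieSubalgebra.toSubmodule_injective
      (Submodule.eq_of_le_of_finrank_le (S₁ := (engel ℂ y).toSubmodule)
        (S₂ := (engel ℂ x).toSubmodule) hle ?_)).ge
    exact ((isRegular_iff_finrank_engel_eq_rank ℂ x).1 hx).le.trans (rank_le_finrank_engel ℂ y)
  exact engel_isBot_of_isMin (Cardinal.natCast_lt_aleph0.le.trans (Cardinal.aleph0_le_mk ℂ))
    (engel ℂ x) ⟨engel ℂ x, x, self_mem_engel ℂ x, rfl⟩ le_rfl hmin ⟨engel ℂ c, c, hc, rfl⟩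

/-- A line through a regular element has only finitely many non-regular points. -/
theorem finite_not_isRegular {x z : g} (hx : IsRegular ℂ x) :
    {t : ℂ | ¬ IsRegular ℂ (x + t • z)}.Finite := by
  classical
  let b := finBasis ℂ g
  let p := (LinearMap.polyCharpoly (ad ℂ g : g →ₗ[ℂ] Module.End ℂ g) b).coeff (rank ℂ g)
  let q : Polynomial ℂ := MvPolynomial.aeval
    (fun i ↦ Polynomial.C (b.repr x i) + Polynomial.C (b.repr z i) * Polynomial.X) p
  have hq (t : ℂ) : q.eval t = MvPolynomial.eval (b.repr (x + t • z)) p := by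
    simp only [q]
    induction p using MvPolynomial.induction_on with
    | C a => simp
    | add p₁ p₂ h₁ h₂ => simp only [map_add, Polynomial.eval_add, h₁, h₂]
    | mul_X p i h =>
      rw [map_mul, Polynomial.eval_mul, h, map_mul, MvPolynomial.aeval_X, MvPolynomial.eval_X,
        map_add, map_smul]
      simp only [Polynomial.eval_add, Polynomial.eval_mul, Polynomial.eval_C, Polynomial.eval_X,
        Finsupp.add_apply, Finsupp.smul_apply, smul_eq_mul, mul_comm t]
  have hreg (t : ℂ) : IsRegular ℂ (x + t • z) ↔ q.eval t ≠ 0 := by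
    rw [hq, isRegular_iff_coeff_polyCharpoly_rank_ne_zero ℂ b]
  have hq₀ : q ≠ 0 := by
    rintro h₀
    have := (hreg 0).1 (by simpa using hx)
    simp [h₀] at this
  simp only [hreg, not_not]
  exact Polynomial.finite_setOfPred_isRoot hq₀

/-- Two elements of `g` are Engel-conjugate under a set `G` of automorphisms if some member of `G`
maps the Engel subalgebra of the first onto that of the second. -/
def EngelConj (G : Set (g ≃ₗ⁅ℂ⁆ g)) (x y : g) : Prop :=
  ∃ φ ∈ G, ∀ z, z ∈ engel ℂ x ↔ φ z ∈ engel ℂ y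

/-- Near a regular element `x` every regular element is conjugate to some `c ∈ engel x`, and
`engel c = engel x` because both have minimal dimension. -/
theorem eventually_engelConj {G : Set (g ≃ₗ⁅ℂ⁆ g)} (hG : ∀ x, expAd x ∈ G) {x : g}
    (hx : IsRegular ℂ x) (z : g) :
    ∀ᶠ t : ℂ in 𝓝 0, IsRegular ℂ (x + t • z) → EngelConj G x (x + t • z) := by
  filter_upwards [eventually_eq_expAd (S := (engel ℂ x).toSubmodule) (self_mem_engel ℂ x)
    (exists_eq_lie_add_engel x) z] with t ⟨u, c, hc, huc⟩ ht
  rw [huc] at ht ⊢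
  rw [isRegular_iff_finrank_engel_eq_rank, finrank_engel_apply] at ht
  have heq : (engel ℂ x).toSubmodule = (engel ℂ c).toSubmodule :=
    Submodule.eq_of_le_of_finrank_le (engel_le_engel_of_isRegular hx hc)
      (ht.le.trans (rank_le_finrank_engel ℂ x))
  refine ⟨expAd u, hG u, fun w ↦ ?_⟩
  rw [apply_mem_engel_iff, LieSubalgebra.toSubmodule_injective heq]

/-- Conjugacy of Cartan subalgebras: the regular points of a complex line form a connected set, on
which conjugacy of Engel subalgebras is an equivalence relation with open classes. -/
theorem engelConj_of_isRegular {G : Set (g ≃ₗ⁅ℂ⁆ g)} (hG : ∀ x, expAd x ∈ G)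
    (hsymm : ∀ φ ∈ G, φ.symm ∈ G) (htrans : ∀ φ ∈ G, ∀ φ' ∈ G, φ.trans φ' ∈ G)
    {x y : g} (hx : IsRegular ℂ x) (hy : IsRegular ℂ y) : EngelConj G x y := by
  let T : Set ℂ := {t | IsRegular ℂ (x + t • (y - x))}
  have hT : IsPreconnected T := by
    have := ((finite_not_isRegular (z := y - x) hx).countable.isConnected_compl_of_one_lt_rank
      (by simp)).isPreconnected
    simpa [Set.compl_ofPred] using! this
  have key := hT.induction₂ (fun s t ↦ EngelConj G (x + s • (y - x)) (x + t • (y - x)))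
    (fun s hs ↦ ?_) ?_ ?_ (x := 0) (y := 1) (by simpa [T] using hx) (by simpa [T] using hy)
  · simpa using key
  · have h₁ := eventually_engelConj hG hs (y - x)
    have h₂ : Tendsto (fun t : ℂ ↦ t - s) (𝓝[T] s) (𝓝 0) := by
      have : Continuous fun t : ℂ ↦ t - s := by fun_prop
      exact ((this.tendsto s).mono_left nhdsWithin_le_nhds).trans (by simp)
    filter_upwards [h₂.eventually h₁, self_mem_nhdsWithin] with t ht htT
    have heq : x + s • (y - x) + (t - s) • (y - x) = x + t • (y - x) := by module
    rw [heq] at ht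
    exact ht htT
  · rintro r s t - - - ⟨φ, hφ, h⟩ ⟨φ', hφ', h'⟩
    exact ⟨φ.trans φ', htrans _ hφ _ hφ', fun w ↦ by rw [h, h', LieEquiv.trans_apply]⟩
  · rintro s t - - ⟨φ, hφ, h⟩
    exact ⟨φ.symm, hsymm _ hφ, fun w ↦ by rw [h, LieEquiv.apply_symm_apply]⟩

/-- An element `h` whose Engel subalgebra is abelian is regular: there are regular elements
arbitrarily near `h`, these are conjugate to some `c ∈ engel h`, and `engel h ≤ engel c`. -/
theorem isRegular_of_engel_abelian {h : g}
    (hab : ∀ x ∈ engel ℂ h, ∀ y ∈ engel ℂ h, ⁅x, y⁆ = 0) : IsRegular ℂ h := by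
  obtain ⟨r, hr⟩ := exists_isRegular ℂ g
  have hfin : {t : ℂ | ¬ IsRegular ℂ (h + t • (r - h))}.Finite := by
    -- read the line from its regular end: `h + t (r - h) = r + (1 - t) (h - r)`
    refine Set.Finite.of_finite_image (f := fun t ↦ 1 - t)
      ((finite_not_isRegular (z := h - r) hr).subset ?_) (fun a _ b _ hab ↦ by simpa using hab)
    rintro _ ⟨t, ht, rfl⟩
    have heq : r + (1 - t) • (h - r) = h + t • (r - h) := by module
    simpa [heq] using ht
  have hev : ∀ᶠ t : ℂ in 𝓝[≠] 0, IsRegular ℂ (h + t • (r - h)) := by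
    have hmem := (hfin.subset (Set.sdiff_subset (t := {0}))).isClosed.isOpen_compl.mem_nhds
      (x := (0 : ℂ)) (by simp)
    filter_upwards [mem_nhdsWithin_of_mem_nhds hmem, self_mem_nhdsWithin] with t ht ht₀
    by_contra hreg
    exact ht ⟨hreg, ht₀⟩
  obtain ⟨t, ht, u, c, hc, huc⟩ := (hev.and ((eventually_eq_expAd (S := (engel ℂ h).toSubmodule)
    (self_mem_engel ℂ h) (exists_eq_lie_add_engel h) (r - h)).filter_mono
      nhdsWithin_le_nhds)).exists
  rw [huc, isRegular_iff_finrank_engel_eq_rank, finrank_engel_apply] at ht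
  have hle : (engel ℂ h).toSubmodule ≤ (engel ℂ c).toSubmodule := fun x hx ↦
    (mem_engel_iff _ _ _).2 ⟨1, by simpa using hab c hc x hx⟩
  rw [isRegular_iff_finrank_engel_eq_rank]
  exact le_antisymm ((Submodule.finrank_mono hle).trans ht.le) (rank_le_finrank_engel ℂ h)

end Conjugacy

/-! ### Grading-reversing endomorphisms of Lie tori -/

namespace LieTorus

variable {ι V N Λ L : Type*} [AddCommGroup V] [Module ℂ V] [AddCommGroup N] [Module ℂ N]
  [AddCommGroup Λ] [LieRing L] [LieAlgebra ℂ L] {P : RootPairing ι ℂ V N} [Finite ι]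
  [P.IsRootSystem] [P.IsCrystallographic] [P.IsIrreducible]
  {𝓛 : P.rootSpan ℤ × Λ → Submodule ℂ L}

namespace IsLieTorus

/-- A root space of a Lie torus is zero or belongs to an `sl₂`-triple with semisimple element
acting through the coroot. -/
theorem eq_bot_or_exists_sl2 (h : IsLieTorus P 𝓛) (i : ι) (l : Λ) :
    𝓛 (P.rootSpanMem ℤ i, l) = ⊥ ∨ ∃ e f : L, 𝓛 (P.rootSpanMem ℤ i, l) = Submodule.span ℂ {e} ∧
      𝓛 (-P.rootSpanMem ℤ i, -l) = Submodule.span ℂ {f} ∧ ⁅e, f⁆ ≠ 0 ∧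
      ∀ (β : P.rootSpan ℤ) (k : Λ), ∀ x ∈ 𝓛 (β, k), ⁅⁅e, f⁆, x⁆ = P.coroot' i (β : V) • x := by
  rcases Cardinal.le_one_iff.1 (h.rank_le_one i l) with h₀ | h₁
  · exact .inl (Submodule.rank_eq_zero.1 h₀)
  · obtain ⟨e, f, he, hf, hef⟩ := h.exists_sl2 i l h₁
    refine .inr ⟨e, f, he, hf, fun hzero ↦ ?_, fun β k x hx ↦ ?_⟩
    · have h₂ := hef (P.rootSpanMem ℤ i) l (.inr ⟨i, rfl⟩) e
        (he ▸ Submodule.mem_span_singleton_self e)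
      have h₃ : P.coroot' i (P.rootSpanMem ℤ i : V) = 2 := P.root_coroot_two i
      rw [hzero, zero_lie, h₃] at h₂
      have he₀ : e = 0 := by simpa using h₂.symm
      rw [he₀, Submodule.span_zero_singleton] at he
      exact one_ne_zero (h₁.symm.trans (Submodule.rank_eq_zero.2 he))
    · by_cases hβ : β = 0 ∨ (β : V) ∈ Set.range P.root
      · exact hef β k hβ x hx
      · rw [not_or] at hβ
        rw [h.eq_bot β k hβ.1 hβ.2, Submodule.mem_bot] at hx
        simp [hx]

/-- An additive property holds on a Lie torus if it holds on the components of degrees `(0, l)`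
and `(α, l)` with `α` a root. -/
theorem induction (h : IsLieTorus P 𝓛) {p : L → Prop}
    (root : ∀ i l, ∀ x ∈ 𝓛 (P.rootSpanMem ℤ i, l), p x) (zero : ∀ l, ∀ x ∈ 𝓛 (0, l), p x)
    (p_zero : p 0) (add : ∀ x y, p x → p y → p (x + y)) (x : L) : p x := by
  have hx : x ∈ ⨆ q, 𝓛 q := h.iSup_eq_top ▸ Submodule.mem_top
  induction hx using Submodule.iSup_induction' with
  | zero => exact p_zero
  | add x y _ _ hx hy => exact add x y hx hy
  | mem q x hx =>
    obtain ⟨β, l⟩ := q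
    by_cases hβ : β = 0
    · subst hβ
      exact zero l x hx
    by_cases hβ' : (β : V) ∈ Set.range P.root
    · obtain ⟨i, hi⟩ := hβ'
      obtain rfl : P.rootSpanMem ℤ i = β := Subtype.ext hi
      exact root i l x hx
    · rw [h.eq_bot β l hβ hβ', Submodule.mem_bot] at hx
      exact hx ▸ p_zero

/-- An endomorphism of a Lie torus that reverses the grading and is `-1` in degree `(0, 0)` is
involutive: it exchanges the lines spanned by `e` and `f` up to scalars `a, b`, and
`⁅e, f⁆ ↦ -⁅e, f⁆` forces `a b = 1`. -/
theorem involutive (h : IsLieTorus P 𝓛) {τ : L →ₗ⁅ℂ⁆ L} (hτ : ∀ p, ∀ x ∈ 𝓛 p, τ x ∈ 𝓛 (-p))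
    (hτ₀ : ∀ x ∈ 𝓛 (0, 0), τ x = -x) (x : L) : τ (τ x) = x := by
  have hroot (i : ι) (l : Λ) (x : L) (hx : x ∈ 𝓛 (P.rootSpanMem ℤ i, l)) : τ (τ x) = x := by
    rcases h.eq_bot_or_exists_sl2 i l with h₀ | ⟨e, f, he, hf, hne, -⟩
    · rw [h₀, Submodule.mem_bot] at hx
      simp [hx]
    have he' : e ∈ 𝓛 (P.rootSpanMem ℤ i, l) := he ▸ Submodule.mem_span_singleton_self e
    have hf' : f ∈ 𝓛 (-P.rootSpanMem ℤ i, -l) := hf ▸ Submodule.mem_span_singleton_self f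
    have hτe := hτ _ e he'
    have hτf := hτ _ f hf'
    rw [Prod.neg_mk, hf, Submodule.mem_span_singleton] at hτe
    rw [Prod.neg_mk, neg_neg, neg_neg, he, Submodule.mem_span_singleton] at hτf
    obtain ⟨a, ha⟩ := hτe
    obtain ⟨b, hb⟩ := hτf
    have hef : ⁅e, f⁆ ∈ 𝓛 (0, 0) := by
      simpa using h.lie_mem _ _ e he' f hf'
    have hab : a * b = 1 := by
      have h₁ := hτ₀ _ hef
      rw [LieHom.map_lie, ← ha, ← hb, smul_lie, lie_smul, ← lie_skew, smul_neg, smul_neg, neg_inj,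
        smul_smul] at h₁
      have h₂ : (a * b - 1) • ⁅e, f⁆ = 0 := by rw [sub_smul, h₁, one_smul, sub_self]
      exact sub_eq_zero.1 ((smul_eq_zero.1 h₂).resolve_right hne)
    rw [he, Submodule.mem_span_singleton] at hx
    obtain ⟨c, rfl⟩ := hx
    rw [map_smul, map_smul, ← ha, map_smul, ← hb, smul_smul a b, hab, one_smul]
  refine h.induction (p := fun x ↦ τ (τ x) = x) hroot (fun l x hx ↦ ?_) (by simp)
    (fun x y hx hy ↦ by rw [map_add, map_add, hx, hy]) x
  rw [h.zero_eq_span] at hx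
  induction hx using Submodule.span_induction with
  | zero => simp
  | add x y _ _ hx hy => rw [map_add, map_add, hx, hy]
  | smul c x _ hx => rw [map_smul, map_smul, hx]
  | mem z hz =>
    obtain ⟨i, k, x, hx, y, hy, rfl⟩ := hz
    rw [← P.rootSpanMem_reflectionPerm_self] at hy
    rw [LieHom.map_lie, LieHom.map_lie, hroot i k x hx, hroot _ _ y hy]

/-- An endomorphism of a Lie torus that reverses the grading and is `-1` in degree `(0, 0)` is a
Chevalley involution, if the component of degree `(0, 0)` is nonzero. -/
theorem exists_isChevalleyInvolution (h : IsLieTorus P 𝓛) {τ : L →ₗ⁅ℂ⁆ L}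
    (hτ : ∀ p, ∀ x ∈ 𝓛 p, τ x ∈ 𝓛 (-p)) (hτ₀ : ∀ x ∈ 𝓛 (0, 0), τ x = -x)
    (hne : 𝓛 (0, 0) ≠ ⊥) : ∃ τ' : L ≃ₗ⁅ℂ⁆ L, IsChevalleyInvolution 𝓛 τ' := by
  have hinv := h.involutive hτ hτ₀
  refine ⟨{ τ with invFun := τ, left_inv := hinv, right_inv := hinv }, ⟨hinv, ?_, fun l ↦ ?_⟩, hτ₀⟩
  · obtain ⟨x, hx, hx₀⟩ := Submodule.exists_mem_ne_zero_of_ne_bot hne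
    refine ⟨x, fun hxτ ↦ hx₀ ?_⟩
    change τ x = x at hxτ
    rw [hτ₀ x hx, neg_eq_iff_add_eq_zero, ← two_smul ℂ] at hxτ
    exact (smul_eq_zero.1 hxτ).resolve_left two_ne_zero
  · change (⨆ α, 𝓛 (α, l)).map (τ : L →ₗ[ℂ] L) = ⨆ α, 𝓛 (α, -l)
    rw [Submodule.map_iSup]
    refine le_antisymm (iSup_le fun α ↦ ?_) (iSup_le fun α ↦ ?_)
    · rintro _ ⟨x, hx, rfl⟩
      exact Submodule.mem_iSup_of_mem (-α) (hτ _ x hx)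
    · intro x hx
      refine Submodule.mem_iSup_of_mem (-α) ⟨τ x, ?_, hinv x⟩
      simpa using hτ _ x hx

end IsLieTorus

end LieTorus

/-! ### Multi-loop algebras -/

namespace MultiLoop

variable {g : Type*} [LieRing g] [LieAlgebra ℂ g] {ν : ℕ} {σ : Fin ν → (g ≃ₗ⁅ℂ⁆ g)}
  {ω : Fin ν → ℂˣ} {h' : LieSubalgebra ℂ g}

/-- The element `x ⊗ z^l` of the loop algebra, with the tensor factors in the other order. -/
noncomputable abbrev monomial (l : Fin ν → ℤ) (x : g) :
    LieAlgebra.loopAlgebra ℂ (Fin ν → ℤ) g :=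
  AddMonoidAlgebra.single l 1 ⊗ₜ[ℂ] x

theorem monomial_injective (l : Fin ν → ℤ) : Function.Injective (monomial (g := g) l) := by
  intro x y hxy
  have := congr(LieAlgebra.LoopAlgebra.toFinsupp ℂ (Fin ν → ℤ) g $hxy)
  exact Finsupp.single_injective l (by simpa using this)

theorem monomial_mem {l : Fin ν → ℤ} {x : g} (hx : x ∈ eigenspace σ ω l) :
    monomial l x ∈ multiLoop σ ω :=
  Submodule.mem_iSup_of_mem (p := fun l ↦ monomialTensor l (eigenspace σ ω l)) l ⟨x, hx, rfl⟩

theorem mem_grading_iff {Q : Submodule ℤ (Module.Dual ℂ h')} {α : Q} {l : Fin ν → ℤ}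
    {y : multiLoop σ ω} : y ∈ grading σ ω h' Q (α, l) ↔
      ∃ x ∈ eigenspace σ ω l, x ∈ weightSpace h' (α : Module.Dual ℂ h') ∧ monomial l x = y := by
  change (∃ x, x ∈ eigenspace σ ω l ⊓ weightSpace h' (α : Module.Dual ℂ h') ∧ monomial l x = y) ↔ _
  simp only [Submodule.mem_inf, and_assoc]

theorem mem_eigenspace_zero {x : g} : x ∈ eigenspace σ ω 0 ↔ ∀ j, σ j x = x := by
  change (∀ j, σ j x = (ω j : ℂ) ^ ((0 : Fin ν → ℤ) j) • x) ↔ _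
  simp

/-- The endomorphism `x ⊗ z^l ↦ χ x ⊗ z^{-l}` of the loop algebra attached to an endomorphism `χ`
of `g`. -/
noncomputable def reverseLoop (ν : ℕ) (χ : g →ₗ⁅ℂ⁆ g) :
    LieAlgebra.loopAlgebra ℂ (Fin ν → ℤ) g →ₗ⁅ℂ⁆ LieAlgebra.loopAlgebra ℂ (Fin ν → ℤ) g :=
  LieAlgebra.ExtendScalars.map
    (AddMonoidAlgebra.mapDomainAlgHom ℂ ℂ (negAddMonoidHom (α := Fin ν → ℤ))) χ

theorem reverseLoop_monomial (χ : g →ₗ⁅ℂ⁆ g) (l : Fin ν → ℤ) (x : g) :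
    reverseLoop ν χ (monomial l x) = monomial (-l) (χ x) := by
  simp [reverseLoop]

theorem reverseLoop_mem {χ : g →ₗ⁅ℂ⁆ g}
    (hχ : ∀ l, ∀ x ∈ eigenspace σ ω l, χ x ∈ eigenspace σ ω (-l))
    {y : LieAlgebra.loopAlgebra ℂ (Fin ν → ℤ) g} (hy : y ∈ multiLoop σ ω) :
    reverseLoop ν χ y ∈ multiLoop σ ω := by
  have hle : (multiLoop σ ω).toSubmodule ≤ (multiLoop σ ω).toSubmodule.comap
      (reverseLoop ν χ : LieAlgebra.loopAlgebra ℂ (Fin ν → ℤ) g →ₗ[ℂ] _) := by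
    refine iSup_le fun l ↦ ?_
    rintro _ ⟨x, hx, rfl⟩
    change reverseLoop ν χ (monomial l x) ∈ multiLoop σ ω
    rw [reverseLoop_monomial]
    exact monomial_mem (hχ l x hx)
  exact hle hy

/-- If `χ` maps each joint eigenspace `g^l` into `g^{-l}`, then `x ⊗ z^l ↦ χ x ⊗ z^{-l}` preserves
the multi-loop algebra. -/
noncomputable def reverse (χ : g →ₗ⁅ℂ⁆ g)
    (hχ : ∀ l, ∀ x ∈ eigenspace σ ω l, χ x ∈ eigenspace σ ω (-l)) :
    multiLoop σ ω →ₗ⁅ℂ⁆ multiLoop σ ω where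
  toFun y := ⟨reverseLoop ν χ y, reverseLoop_mem hχ y.2⟩
  map_add' x y := Subtype.ext (map_add (reverseLoop ν χ) x.1 y.1)
  map_smul' c y := Subtype.ext (map_smul (reverseLoop ν χ) c y.1)
  map_lie' {x y} := Subtype.ext (LieHom.map_lie (reverseLoop ν χ) x.1 y.1)

theorem coe_reverse (χ : g →ₗ⁅ℂ⁆ g)
    (hχ : ∀ l, ∀ x ∈ eigenspace σ ω l, χ x ∈ eigenspace σ ω (-l)) (y : multiLoop σ ω) :
    (reverse χ hχ y : LieAlgebra.loopAlgebra ℂ (Fin ν → ℤ) g) = reverseLoop ν χ y := rfl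

/-- If moreover `χ` is `-1` on `h'`, then it maps `α`-weight vectors to `-α`-weight vectors, so that
the induced endomorphism reverses the full grading. -/
theorem reverse_mem_grading {Q : Submodule ℤ (Module.Dual ℂ h')} {χ : g →ₗ⁅ℂ⁆ g}
    (hχ : ∀ l, ∀ x ∈ eigenspace σ ω l, χ x ∈ eigenspace σ ω (-l)) (hχ' : ∀ h ∈ h', χ h = -h)
    (p : Q × (Fin ν → ℤ)) (y : multiLoop σ ω) (hy : y ∈ grading σ ω h' Q p) :
    reverse χ hχ y ∈ grading σ ω h' Q (-p) := by
  obtain ⟨α, l⟩ := p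
  obtain ⟨x, hx, hxα, hxy⟩ := mem_grading_iff.1 hy
  rw [Prod.neg_mk, mem_grading_iff]
  refine ⟨χ x, hχ l x hx, fun h ↦ ?_, by rw [coe_reverse, ← hxy, reverseLoop_monomial]⟩
  have h₁ : χ ⁅(h : g), x⁆ = χ ((α : Module.Dual ℂ h') h • x) := congrArg χ (hxα h)
  rw [LieHom.map_lie, hχ' h h.2, neg_lie, map_smul] at h₁
  rw [← neg_neg ⁅(h : g), χ x⁆, h₁]
  simp

/-- If all `σ j` have order at most `2`, then the eigenvalues are `±1`, so that `g^l = g^{-l}`. -/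
theorem isReversing_refl (hσ : ∀ j x, σ j (σ j x) = x) : IsReversing σ ω h' LieEquiv.refl where
  apply_eq _ _ := rfl
  map_mem l x hx j := by
    change σ j x = (ω j : ℂ) ^ (-l j) • x
    have hx' : σ j x = (ω j : ℂ) ^ l j • x := hx j
    have h₁ := hσ j x
    rw [hx', map_smul, hx'] at h₁
    have hne : (ω j : ℂ) ^ l j ≠ 0 := zpow_ne_zero _ (ω j).ne_zero
    rw [hx', zpow_neg, eq_inv_smul_iff₀ hne, h₁]

/-- A subalgebra acting diagonalizably on a simple Lie algebra is abelian. -/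
theorem lie_eq_zero_of_mem [FiniteDimensional ℂ g] [LieAlgebra.IsSimple ℂ g]
    (hdiag : ⨆ α : Module.Dual ℂ h', weightSpace h' α = ⊤) {h k : g} (hh : h ∈ h') (hk : k ∈ h') :
    ⁅h, k⁆ = 0 := by
  have hmem : ⁅h, k⁆ ∈ LieAlgebra.center ℂ g := by
    rw [LieModule.mem_maxTrivSubmodule]
    intro x
    rw [← lie_skew, neg_eq_zero]
    have hx : x ∈ ⨆ α : Module.Dual ℂ h', weightSpace h' α := hdiag ▸ Submodule.mem_top
    induction hx using Submodule.iSup_induction' with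
    | zero => simp
    | add x y _ _ hx hy => simp [hx, hy]
    | mem α x hx =>
      have h₁ : ⁅h, x⁆ = α ⟨h, hh⟩ • x := hx ⟨h, hh⟩
      have h₂ : ⁅k, x⁆ = α ⟨k, hk⟩ • x := hx ⟨k, hk⟩
      rw [lie_lie, h₁, h₂, lie_smul, lie_smul, h₁, h₂, smul_comm, sub_self]
  rw [LieAlgebra.center_eq_bot] at hmem
  simpa using hmem

/-- The fixed-point subalgebra of a family of automorphisms. -/
def fixedSubalgebra (σ : Fin ν → (g ≃ₗ⁅ℂ⁆ g)) : LieSubalgebra ℂ g where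
  carrier := {x | ∀ j, σ j x = x}
  add_mem' hx hy j := by rw [map_add, hx j, hy j]
  zero_mem' j := map_zero _
  smul_mem' c x hx j := by rw [map_smul, hx j]
  lie_mem' {x y} hx hy j := by
    have h₁ : σ j x = x := hx j
    have h₂ : σ j y = y := hy j
    rw [LieEquiv.map_lie, h₁, h₂]

section Torus

variable [FiniteDimensional ℂ g]
  {ι N : Type*} [AddCommGroup N] [Module ℂ N] [Finite ι]
  {P : RootPairing ι ℂ (Module.Dual ℂ h') N} [P.IsRootSystem] [P.IsCrystallographic]
  [P.IsIrreducible]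

/-- In a centerless Lie torus `M(g, σ)` the component of degree `(0, 0)` is `h' ⊗ 1`: the
semisimple elements of the `sl₂`-triples that span it act like elements of `h'`. -/
theorem exists_monomial_eq_of_mem_grading_zero
    (hfix : ∀ j, ∀ x ∈ h', σ j x = x)
    (htorus : LieTorus.IsLieTorus P (grading σ ω h' (P.rootSpan ℤ)))
    (hcenter : LieAlgebra.center ℂ (multiLoop σ ω) = ⊥)
    {y : multiLoop σ ω} (hy : y ∈ grading σ ω h' (P.rootSpan ℤ) (0, 0)) :
    ∃ h ∈ h', monomial 0 h = (y : LieAlgebra.loopAlgebra ℂ (Fin ν → ℤ) g) := by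
  rw [htorus.zero_eq_span] at hy
  induction hy using Submodule.span_induction with
  | zero => exact ⟨0, h'.zero_mem, by simp [monomial]⟩
  | add y₁ y₂ _ _ h₁ h₂ =>
    obtain ⟨k₁, hk₁, h₁⟩ := h₁
    obtain ⟨k₂, hk₂, h₂⟩ := h₂
    exact ⟨k₁ + k₂, h'.add_mem hk₁ hk₂, by simp [monomial, TensorProduct.tmul_add, h₁, h₂]⟩
  | smul c y₁ _ h₁ =>
    obtain ⟨k₁, hk₁, h₁⟩ := h₁
    exact ⟨c • k₁, h'.smul_mem c hk₁, by simp [monomial, TensorProduct.tmul_smul, h₁]⟩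
  | mem z hz =>
    obtain ⟨i, l, x, hx, y, hy, rfl⟩ := hz
    rcases htorus.eq_bot_or_exists_sl2 i l with h₀ | ⟨e, f, he, hf, -, hef⟩
    · rw [h₀, Submodule.mem_bot] at hx
      exact ⟨0, h'.zero_mem, by simp [monomial, hx]⟩
    rw [he, Submodule.mem_span_singleton] at hx
    rw [zero_sub, hf, Submodule.mem_span_singleton] at hy
    obtain ⟨a, rfl⟩ := hx
    obtain ⟨b, rfl⟩ := hy
    -- the coroot of `i`, a functional on the dual of `h'`, is evaluation at some `h ∈ h'`
    obtain ⟨h, hh⟩ := (Module.evalEquiv ℂ h').surjective (P.coroot' i)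
    have hh' (β : Module.Dual ℂ h') : P.coroot' i β = β h := by rw [← hh]; rfl
    let w : multiLoop σ ω := ⟨monomial 0 (h : g),
      monomial_mem (mem_eigenspace_zero.2 fun j ↦ hfix j h h.2)⟩
    have hcentral : ⁅e, f⁆ - w ∈ LieAlgebra.center ℂ (multiLoop σ ω) := by
      rw [LieModule.mem_maxTrivSubmodule]
      intro x
      rw [← lie_skew, neg_eq_zero]
      have hx : x ∈ ⨆ q, grading σ ω h' (P.rootSpan ℤ) q := htorus.iSup_eq_top ▸ Submodule.mem_top
      induction hx using Submodule.iSup_induction' with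
      | zero => simp
      | add x y _ _ hx hy => rw [lie_add, hx, hy, add_zero]
      | mem q x hx =>
        obtain ⟨β, k⟩ := q
        rw [sub_lie, hef β k x hx, hh', sub_eq_zero]
        obtain ⟨u, -, hu, hux⟩ := mem_grading_iff.1 hx
        apply Subtype.ext
        change (β : Module.Dual ℂ h') h • (x : LieAlgebra.loopAlgebra ℂ (Fin ν → ℤ) g) =
          ⁅monomial 0 (h : g), (x : LieAlgebra.loopAlgebra ℂ (Fin ν → ℤ) g)⁆
        rw [← hux, LieAlgebra.ExtendScalars.bracket_tmul, AddMonoidAlgebra.single_mul_single,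
          zero_add, one_mul, hu h, TensorProduct.tmul_smul]
    rw [hcenter, LieSubmodule.mem_bot, sub_eq_zero] at hcentral
    refine ⟨(a * b) • (h : g), h'.smul_mem _ h.2, ?_⟩
    rw [smul_lie, lie_smul, hcentral, smul_smul]
    simp [w, monomial, TensorProduct.tmul_smul]

/-- The subalgebra `h'` contains its centralizer in the fixed-point algebra. -/
theorem mem_of_mem_weightSpace_zero
    (hfix : ∀ j, ∀ x ∈ h', σ j x = x)
    (htorus : LieTorus.IsLieTorus P (grading σ ω h' (P.rootSpan ℤ)))
    (hcenter : LieAlgebra.center ℂ (multiLoop σ ω) = ⊥) {x : g} (hx : x ∈ fixedSubalgebra σ)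
    (hx₀ : x ∈ weightSpace h' 0) : x ∈ h' := by
  have hxσ : x ∈ eigenspace σ ω 0 := mem_eigenspace_zero.2 hx
  obtain ⟨h, hh, heq⟩ := exists_monomial_eq_of_mem_grading_zero hfix htorus hcenter
    (y := ⟨monomial 0 x, monomial_mem hxσ⟩) (mem_grading_iff.2 ⟨x, hxσ, hx₀, rfl⟩)
  rwa [← monomial_injective 0 heq]

/-- The fixed-point algebra has an element with Engel subalgebra `h'`: any `h ∈ h'` at which no
root vanishes. -/
theorem exists_engel_eq [LieAlgebra.IsSimple ℂ g]
    (hfix : ∀ j, ∀ x ∈ h', σ j x = x)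
    (hdiag : ⨆ α : Module.Dual ℂ h', weightSpace h' α = ⊤)
    (hP : Set.range P.root = {α | α ≠ 0 ∧ weightSpace h' α ≠ ⊥})
    (htorus : LieTorus.IsLieTorus P (grading σ ω h' (P.rootSpan ℤ)))
    (hcenter : LieAlgebra.center ℂ (multiLoop σ ω) = ⊥) :
    ∃ h : fixedSubalgebra σ, ∀ x : fixedSubalgebra σ,
      x ∈ LieSubalgebra.engel ℂ h ↔ (x : g) ∈ h' := by
  obtain ⟨h, hh⟩ := Module.Dual.exists_forall_ne_zero_of_forall_exists P.root fun i ↦ by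
    by_contra! h₀
    exact P.ne_zero i (LinearMap.ext h₀)
  have hle (α : Module.Dual ℂ h') :
      weightSpace h' α ≤ (LieAlgebra.ad ℂ g (h : g)).maxGenEigenspace (α h) := by
    intro x hx
    refine (Module.End.mem_maxGenEigenspace _ _ _).2 ⟨1, ?_⟩
    simp [hx h]
  have hengel : (LieAlgebra.ad ℂ g (h : g)).maxGenEigenspace 0 = weightSpace h' 0 := by
    refine Module.End.maxGenEigenspace_zero_eq_of_sup_eq_top _ (U := ⨆ α ≠ 0, weightSpace h' α)
      (hle 0) (iSup₂_le fun α hα ↦ ?_) ?_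
    · by_cases hbot : weightSpace h' α = ⊥
      · simp [hbot]
      obtain ⟨i, rfl⟩ : α ∈ Set.range P.root := hP ▸ ⟨hα, hbot⟩
      exact (hle _).trans (le_iSup₂_of_le _ (hh i) le_rfl)
    · rw [eq_top_iff, ← hdiag]
      refine iSup_le fun α ↦ ?_
      rcases eq_or_ne α 0 with rfl | hα
      · exact le_sup_left
      · exact le_sup_of_le_right (le_iSup₂_of_le α hα le_rfl)
  refine ⟨⟨h, fun j ↦ hfix j h h.2⟩, fun x ↦ ?_⟩
  have h₁ : x ∈ LieSubalgebra.engel ℂ (⟨h, fun j ↦ hfix j h h.2⟩ : fixedSubalgebra σ) ↔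
      (x : g) ∈ (LieAlgebra.ad ℂ g (h : g)).maxGenEigenspace 0 :=
    mem_engel_subalgebra_iff
  rw [h₁, hengel]
  refine ⟨mem_of_mem_weightSpace_zero hfix htorus hcenter x.2, fun hx k ↦ ?_⟩
  rw [lie_eq_zero_of_mem hdiag k.2 hx]
  simp

end Torus

end MultiLoop

/-! ### Construction of the Chevalley involution -/

namespace MultiLoop

variable {g : Type*} [LieRing g] [LieAlgebra ℂ g] {ν : ℕ}

theorem symm_comm {Φ s : g ≃ₗ⁅ℂ⁆ g} (h : ∀ x, Φ (s x) = s (Φ x)) (x : g) :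
    Φ.symm (s x) = s (Φ.symm x) := by
  have h' := congrArg Φ.symm (h (Φ.symm x))
  rw [Φ.symm_apply_apply, Φ.apply_symm_apply] at h'
  exact h'.symm

variable [FiniteDimensional ℂ g] {σ : Fin ν → (g ≃ₗ⁅ℂ⁆ g)}

/-- Inner automorphisms `exp (ad x)` of the fixed-point algebra extend to automorphisms of `g`
commuting with all `σ j`. Hence two Cartan subalgebras of the fixed-point algebra are conjugate
under such an automorphism. -/
theorem exists_comm_equiv_of_isRegular {d h : fixedSubalgebra σ} (hd : LieAlgebra.IsRegular ℂ d)
    (hh : LieAlgebra.IsRegular ℂ h) : ∃ Φ : g ≃ₗ⁅ℂ⁆ g, (∀ j x, Φ (σ j x) = σ j (Φ x)) ∧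
      ∀ x ∈ LieSubalgebra.engel ℂ h, ∃ y ∈ LieSubalgebra.engel ℂ d, Φ y = x := by
  let G : Set (fixedSubalgebra σ ≃ₗ⁅ℂ⁆ fixedSubalgebra σ) :=
    {φ | ∃ Φ : g ≃ₗ⁅ℂ⁆ g, (∀ j x, Φ (σ j x) = σ j (Φ x)) ∧ ∀ y : fixedSubalgebra σ,
      Φ y = φ y}
  have hexp (x : fixedSubalgebra σ) : expAd x ∈ G := by
    refine ⟨expAd (x : g), fun j y ↦ ?_, fun y ↦ ?_⟩
    · have h := map_expAd (σ j).toLieHom (x : g) y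
      have hx : (σ j).toLieHom (x : g) = x := x.2 j
      rw [hx] at h
      exact h.symm
    · exact (map_expAd (fixedSubalgebra σ).incl x y).symm
  have hsymm : ∀ φ ∈ G, φ.symm ∈ G := by
    rintro φ ⟨Φ, hΦ, hφ⟩
    refine ⟨Φ.symm, fun j ↦ symm_comm (hΦ j), fun y ↦ ?_⟩
    have h := congrArg Φ.symm (hφ (φ.symm y))
    rw [Φ.symm_apply_apply, φ.apply_symm_apply] at h
    exact h.symm
  have htrans : ∀ φ ∈ G, ∀ φ' ∈ G, φ.trans φ' ∈ G := by
    rintro φ ⟨Φ, hΦ, hφ⟩ φ' ⟨Φ', hΦ', hφ'⟩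
    refine ⟨Φ.trans Φ', fun j x ↦ ?_, fun y ↦ ?_⟩
    · rw [LieEquiv.trans_apply, LieEquiv.trans_apply, hΦ, hΦ']
    · rw [LieEquiv.trans_apply, LieEquiv.trans_apply, hφ, hφ']
  obtain ⟨φ, ⟨Φ, hΦ, hφ⟩, hmem⟩ := engelConj_of_isRegular hexp hsymm htrans hd hh
  refine ⟨Φ, hΦ, fun x hx ↦ ⟨φ.symm x, ?_, ?_⟩⟩
  · rwa [hmem, φ.apply_symm_apply]
  · rw [hφ, φ.apply_symm_apply]

variable [LieAlgebra.IsSimple ℂ g]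

/-- Let `h'` be the Engel subalgebra of an element of the fixed-point algebra of a family of graph
automorphisms. If `h'` is abelian, then some automorphism of `g` commuting with the graph
automorphisms is `-1` on `h'`: a conjugate of the Chevalley involution. -/
theorem exists_comm_equiv_eq_neg {κ : Type*} [Finite κ] {H : LieSubalgebra ℂ g}
    (b : LieAlgebra.Basis κ H) (hgraph : ∀ j, IsGraphAutomorphism b (σ j)) {h' : LieSubalgebra ℂ g}
    (hfix : ∀ j, ∀ x ∈ h', σ j x = x) (hab : ∀ x ∈ h', ∀ y ∈ h', ⁅x, y⁆ = 0)
    {h : fixedSubalgebra σ}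
    (hh : ∀ x : fixedSubalgebra σ, x ∈ LieSubalgebra.engel ℂ h ↔ (x : g) ∈ h') :
    ∃ θ : g ≃ₗ⁅ℂ⁆ g, (∀ j x, θ (σ j x) = σ j (θ x)) ∧ ∀ x ∈ h', θ x = -x := by
  have := Fintype.ofFinite κ
  obtain ⟨d, hd⟩ := b.exists_baseSupp_eq_one
  let d' : fixedSubalgebra σ := ⟨d, fun j ↦ b.apply_eq_of_baseSupp_eq_one hd (hgraph j)⟩
  have hd' (x : fixedSubalgebra σ) : x ∈ LieSubalgebra.engel ℂ d' ↔ (x : g) ∈ H := by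
    rw [mem_engel_subalgebra_iff, b.engel_eq_of_baseSupp_eq_one hd]
  have hdreg : LieAlgebra.IsRegular ℂ d' := by
    refine isRegular_of_engel_abelian fun x hx y hy ↦ Subtype.ext ?_
    have := b.isLieAbelian_cartan
    exact congrArg (fun z : H ↦ (z : g))
      (LieModule.IsTrivial.trivial (⟨x, (hd' x).1 hx⟩ : H) (⟨y, (hd' y).1 hy⟩ : H))
  have hhreg : LieAlgebra.IsRegular ℂ h :=
    isRegular_of_engel_abelian fun x hx y hy ↦
      Subtype.ext (hab x ((hh x).1 hx) y ((hh y).1 hy))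
  obtain ⟨Φ, hΦ, hmem⟩ := exists_comm_equiv_of_isRegular hdreg hhreg
  refine ⟨(Φ.symm.trans b.chevalleyInvolution).trans Φ, fun j x ↦ ?_, fun x hx ↦ ?_⟩
  · simp only [LieEquiv.trans_apply]
    rw [symm_comm (hΦ j), b.chevalleyInvolution_comm (hgraph j), hΦ]
  · obtain ⟨y, hy, hyx⟩ := hmem ⟨x, fun j ↦ hfix j x hx⟩ ((hh _).2 hx)
    change Φ y = x at hyx
    simp only [LieEquiv.trans_apply]
    rw [← hyx, Φ.symm_apply_apply, b.chevalleyInvolution_of_mem ((hd' y).1 hy), map_neg]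

end MultiLoop

theorem corollary6p3 {g : Type*} [LieRing g] [LieAlgebra ℂ g] [FiniteDimensional ℂ g]
    [LieAlgebra.IsSimple ℂ g] {ν : ℕ}
    -- commuting automorphisms `σ_j` with periods `m_j`, and primitive `m_j`-th roots of unity
    (σ : Fin ν → (g ≃ₗ⁅ℂ⁆ g)) (hcomm : ∀ i j x, σ i (σ j x) = σ j (σ i x))
    (m : Fin ν → ℕ) (hm : ∀ j, 0 < m j) (hσm : ∀ j x, (σ j)^[m j] x = x)
    (ω : Fin ν → ℂˣ) (hω : ∀ j, IsPrimitiveRoot (ω j) (m j))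
    -- all `σ_j` are graph automorphisms for one choice of Chevalley generators of `g`
    {κ : Type*} [Finite κ] {H : LieSubalgebra ℂ g} (b : LieAlgebra.Basis κ H)
    (hgraph : ∀ j, MultiLoop.IsGraphAutomorphism b (σ j))
    -- `h'` is an ad-diagonalizable subalgebra of `g` fixed pointwise by the `σ_j`
    (h' : LieSubalgebra ℂ g) (hfix : ∀ j, ∀ x ∈ h', σ j x = x)
    (hdiag : ⨆ α : Module.Dual ℂ h', MultiLoop.weightSpace h' α = ⊤)
    -- the set of weights of `h'` on `g` is the root system `P`
    {ι N : Type*} [AddCommGroup N] [Module ℂ N] [Finite ι]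
    (P : RootPairing ι ℂ (Module.Dual ℂ h') N) [P.IsRootSystem] [P.IsCrystallographic]
    [P.IsIrreducible]
    (hP : Set.range P.root = {α | α ≠ 0 ∧ MultiLoop.weightSpace h' α ≠ ⊥})
    -- `M(g, σ) = LT(g, σ, h')` is an fgc centerless Lie torus
    (htorus : LieTorus.IsLieTorus P (MultiLoop.grading σ ω h' (P.rootSpan ℤ)))
    (hcenter : LieAlgebra.center ℂ (MultiLoop.multiLoop σ ω) = ⊥)
    (hfgc : LieTorus.IsFgc (MultiLoop.multiLoop σ ω)) :
    ((∃ ψ : g ≃ₗ⁅ℂ⁆ g, MultiLoop.IsReversing σ ω h' ψ) →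
      ∃ τ : MultiLoop.multiLoop σ ω ≃ₗ⁅ℂ⁆ MultiLoop.multiLoop σ ω,
        LieTorus.IsChevalleyInvolution (MultiLoop.grading σ ω h' (P.rootSpan ℤ)) τ) ∧
    ((∀ j x, σ j (σ j x) = x) →
      MultiLoop.IsReversing σ ω h' LieEquiv.refl ∧
      ∃ τ : MultiLoop.multiLoop σ ω ≃ₗ⁅ℂ⁆ MultiLoop.multiLoop σ ω,
        LieTorus.IsChevalleyInvolution (MultiLoop.grading σ ω h' (P.rootSpan ℤ)) τ) := by
  have hab : ∀ x ∈ h', ∀ y ∈ h', ⁅x, y⁆ = 0 := fun x hx y hy ↦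
    MultiLoop.lie_eq_zero_of_mem hdiag hx hy
  have key (hψ : ∃ ψ : g ≃ₗ⁅ℂ⁆ g, MultiLoop.IsReversing σ ω h' ψ) :
      ∃ τ : MultiLoop.multiLoop σ ω ≃ₗ⁅ℂ⁆ MultiLoop.multiLoop σ ω,
        LieTorus.IsChevalleyInvolution (MultiLoop.grading σ ω h' (P.rootSpan ℤ)) τ := by
    obtain ⟨ψ, hψ⟩ := hψ
    obtain ⟨h, hh⟩ := MultiLoop.exists_engel_eq hfix hdiag hP htorus hcenter
    obtain ⟨θ, hθσ, hθ⟩ := MultiLoop.exists_comm_equiv_eq_neg b hgraph hfix hab hh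
    let χ : g →ₗ⁅ℂ⁆ g := (θ.trans ψ).toLieHom
    have hχ : ∀ l, ∀ x ∈ MultiLoop.eigenspace σ ω l, χ x ∈ MultiLoop.eigenspace σ ω (-l) := by
      refine fun l x hx ↦ hψ.map_mem l _ fun j ↦ ?_
      have hx' : σ j x = (ω j : ℂ) ^ l j • x := hx j
      change σ j (θ x) = _ • θ x
      rw [← hθσ, hx', map_smul]
    have hχ' : ∀ x ∈ h', χ x = -x := fun x hx ↦ by
      change ψ (θ x) = -x
      rw [hθ x hx, map_neg, hψ.apply_eq x hx]
    refine htorus.exists_isChevalleyInvolution (MultiLoop.reverse_mem_grading hχ hχ')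
      (fun y hy ↦ Subtype.ext ?_) ?_
    · obtain ⟨k, hk, hky⟩ :=
        MultiLoop.exists_monomial_eq_of_mem_grading_zero hfix htorus hcenter hy
      rw [MultiLoop.coe_reverse, ← hky, MultiLoop.reverseLoop_monomial, hχ' k hk, neg_zero]
      change _ = -(y : LieAlgebra.loopAlgebra ℂ (Fin ν → ℤ) g)
      rw [← hky, MultiLoop.monomial, TensorProduct.tmul_neg]
    · have hV : Nontrivial (Module.Dual ℂ h') := RootPairing.IsIrreducible.nontrivial P
      obtain ⟨k, hk⟩ := @exists_ne h' ((Module.nontrivial_dual_iff ℂ).1 hV) 0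
      have hkσ : (k : g) ∈ MultiLoop.eigenspace σ ω 0 :=
        MultiLoop.mem_eigenspace_zero.2 fun j ↦ hfix j k k.2
      refine Submodule.ne_bot_iff _ |>.2 ⟨⟨_, MultiLoop.monomial_mem hkσ⟩,
        MultiLoop.mem_grading_iff.2 ⟨k, hkσ, fun h ↦ ?_, rfl⟩, fun h₀ ↦ hk (Subtype.ext ?_)⟩
      · rw [hab h h.2 k k.2]
        simp
      · refine MultiLoop.monomial_injective 0 ((congrArg Subtype.val h₀).trans ?_)
        simp [MultiLoop.monomial]
  exact ⟨key, fun hσ ↦ ⟨MultiLoop.isReversing_refl hσ, key ⟨_, MultiLoop.isReversing_refl hσ⟩⟩⟩
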